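/- Let $(\Omega,\mathcal A)$ be a measurable space with countably generated $\sigma$-algebra, let $K$ be a Markov kernel on $\Omega$ and let $\pi$ be a probability measure on $\Omega$. Assume that $K$ is lazy, i.e. $K(x,\{x\})\ge \tfrac12$ for all $x\in\Omega$, and reversible with respect to $\pi$, i.e. $\int_B K(x,A)\,\pi(dx)=\int_A K(x,B)\,\pi(dx)$ for all $A,B\in\mathcal A$. Let $$\phi=\phi(K,\pi)=\inf_{A\in\mathcal A,\ 0<\pi(A)\le 1/2}\frac{\int_A K(x,A^c)\,\pi(dx)}{\pi(A)}\in[0,\infty]$$ be its conductance (with $\inf\emptyset=\infty$). Let $\nu$ be a probability measure on $\Omega$ with a bounded density $\frac{d\nu}{d\pi}$ with respect to $\pi$, and let $X_1,X_2,\dots$ be a Markov chain with transition kernel $K$ and initial distribution $\nu$ (so $X_1\sim\nu$). For $f\in L_\infty(\Omega,\pi)$, $n\ge 1$ and $n_0\ge 0$ put $$S(f)=\int_\Omega f\,d\pi,\qquad S_{n,n_0}(f)=\frac1n\sum_{j=1}^n f(X_{j+n_0}),\qquad e(S_{n,n_0},f)=\bigl(\mathbf E|S_{n,n_0}(f)-S(f)|^2\bigr)^{1/2},$$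 and for $\varepsilon>0$ let $\operatorname{cost}(f,\varepsilon)$ be the smallest number $n+n_0$ of time steps, over all $n\ge1$ and $n_0\ge0$, with $e(S_{n,n_0},f)\le\varepsilon$ (and $\infty$ if there is none). The quotients below are taken in $[0,\infty]$, with $0/0=0$, $0\cdot\infty=0$, $a/0=\infty$ for $a>0$ and $a/\infty=0$ for $a<\infty$; the ceiling of $\infty$ is $\infty$. All bounds are finite when $0<\phi<\infty$. 1. For all integers $n\ge1$ and $n_0\ge0$ with $n_0\ge \dfrac{\log\|\frac{d\nu}{d\pi}\|_\infty}{\phi^2}$, $$e(S_{n,n_0},f)\le\frac{10}{\phi\,\sqrt n}\,\|f\|_\infty .$$ 2. If $\|f\|_\infty\neq0$ and $\phi<\infty$, then for every $\varepsilon>0$ $$\operatorname{cost}(f,\varepsilon)\le\left\lceil\frac{\log\|\frac{d\nu}{d\pi}\|_\infty}{\phi^2}\right\rceil+\left\lceil\frac{100\,\|f\|_\infty^2}{\phi^2\,\varepsilon^2}\right\rceil .$$ -/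

import Mathlib

open MeasureTheory ProbabilityTheory
open scoped ENNReal

noncomputable section

/-- A transition kernel is lazy if it holds at every point with probability at least `1/2`. -/
def IsLazy {Ω : Type*} [MeasurableSpace Ω] (K : Kernel Ω Ω) : Prop :=
  ∀ x, 1 / 2 ≤ K x {x}

/-- The conductance `φ(K,π) = inf_{0 < π(A) ≤ 1/2} π(A)⁻¹ ∫_A K(x,Aᶜ) π(dx)`, with values in
`[0,∞]`; the infimum over the empty family is `∞`. -/
def conductance {Ω : Type*} [MeasurableSpace Ω] (K : Kernel Ω Ω) (π : Measure Ω) : ℝ≥0∞ :=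
  ⨅ (A : Set Ω) (_ : MeasurableSet A) (_ : 0 < π A) (_ : π A ≤ 1 / 2),
    (∫⁻ x in A, K x Aᶜ ∂π) / π A

/-- `X 0, X 1, X 2, …` is a Markov chain with initial distribution `ν` and transition kernel `K`,
on the probability space `(Ω', P)`: `X 0` has law `ν`, and given `(X 0, …, X n)` the conditional
distribution of `X (n + 1)` is `K (X n) ·`. -/
structure IsMarkovChain {Ω Ω' : Type*} [MeasurableSpace Ω] [MeasurableSpace Ω']
    (X : ℕ → Ω' → Ω) (K : Kernel Ω Ω) (ν : Measure Ω) (P : Measure Ω') : Prop where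
  initial : HasLaw (X 0) ν P
  step : ∀ n : ℕ, HasCondDistrib (X (n + 1)) (fun ω (i : Fin (n + 1)) => X i ω)
    (K.comap (fun x : Fin (n + 1) → Ω => x (Fin.last n)) (measurable_pi_apply _)) P

/-- The estimator `S_{n,n₀}(f) = (1/n) ∑_{j=1}^n f(X_{j+n₀})`, where the chain
`X_1, X_2, …` is written `X 0, X 1, …` (so that `X_{j+n₀}` with `1 ≤ j ≤ n` is `X (j + n₀)` with
`0 ≤ j < n`). It uses the first `n + n₀` states of the chain. -/
def mcmcEstimator {Ω Ω' : Type*} (X : ℕ → Ω' → Ω) (n n₀ : ℕ) (f : Ω → ℝ) (ω : Ω') : ℝ :=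
  (1 / (n : ℝ)) * ∑ j ∈ Finset.range n, f (X (j + n₀) ω)

/-- The root mean square error `e(S_{n,n₀},f) = (E|S_{n,n₀}(f) - S(f)|²)^{1/2} ∈ [0,∞]`, with
`S(f) = ∫ f dπ`. -/
def mcmcError {Ω Ω' : Type*} [MeasurableSpace Ω] [MeasurableSpace Ω']
    (X : ℕ → Ω' → Ω) (P : Measure Ω') (π : Measure Ω) (n n₀ : ℕ) (f : Ω → ℝ) : ℝ≥0∞ :=
  (∫⁻ ω, ‖mcmcEstimator X n n₀ f ω - ∫ x, f x ∂π‖ₑ ^ 2 ∂P) ^ (1 / 2 : ℝ)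

/-- `cost(f,ε)`: the least number `n + n₀` of time steps, over all sample sizes `n ≥ 1` and
burn-in times `n₀`, for which `S_{n,n₀}(f)` has error at most `ε` (`∞` if there is none). -/
def mcmcCost {Ω Ω' : Type*} [MeasurableSpace Ω] [MeasurableSpace Ω']
    (X : ℕ → Ω' → Ω) (P : Measure Ω') (π : Measure Ω) (f : Ω → ℝ) (ε : ℝ) : ℕ∞ :=
  ⨅ (n : ℕ) (n₀ : ℕ) (_ : 1 ≤ n) (_ : mcmcError X P π n n₀ f ≤ ENNReal.ofReal ε),
    ((n + n₀ : ℕ) : ℕ∞)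

/-- The norm `‖dν/dπ‖_∞ ∈ [0,∞]`, the essential supremum of the density. -/
def densityNorm {Ω : Type*} [MeasurableSpace Ω] (ν π : Measure Ω) : ℝ≥0∞ :=
  essSup (ν.rnDeriv π) π

/-- The burn-in bound `log ‖dν/dπ‖_∞ / φ(K,π)² ∈ [0,∞]`. For probability measures `ν ≪ π` with
bounded density the logarithm is a nonnegative real number. -/
def burnIn {Ω : Type*} [MeasurableSpace Ω] (K : Kernel Ω Ω) (ν π : Measure Ω) : ℝ≥0∞ :=
  ENNReal.ofReal (Real.log (densityNorm ν π).toReal) / conductance K π ^ 2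

end

/-!
The proof works with bounded measurable functions and the transition operator
`(Ph)(x) = ∫ h(y) K(x,dy)`, which is symmetric for the inner product of `L²(π)` because `K` is
reversible, and positive semidefinite because `K` is lazy. Write `φ` for the conductance; apart from
degenerate cases `0 < φ ≤ 1`, and `β = 1 - φ²/2`.

*Spectral gap.* Cheeger's inequality `integral_mul_transOp_le` says `⟨g, Pg⟩ ≤ β ‖g‖²` for all `g`
of mean zero. For `h ≥ 0` supported on at most half of the space, the layer cake formula applied to
`h²` gives `2 φ ‖h‖² ≤ ∫∫ |h(x)² - h(y)²| K(x,dy) π(dx)`, and the Cauchy–Schwarz inequality turns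
this into `⟨h, Ph⟩² ≤ (1 - φ²) ‖h‖⁴`. The general case follows by splitting `g` at a median. As `P`
is positive semidefinite, the bound on the quadratic form is a bound `‖Pg‖ ≤ β ‖g‖`
(`integral_transOp_sq_le`).

*Burn-in.* If `ν` has density `D` bounded by `M`, then the law of the `m`-th state has density
`P^m D`, and `‖P^m D - 1‖ ≤ β^m √M ≤ exp(-m φ²/2) √M`, which is at most one for
`m ≥ log M / φ²`.

*Correlations.* Let `g = f - S(f)` and `m ≥ n₀`. Then `E g(X_m) g(X_{m+l})` is the integral of
`P^m D · g · P^l g`; writing `P^m D = 1 + (P^m D - 1)`, two applications of the Cauchy–Schwarz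
inequality bound it by `3 ‖f‖² β^l`, where `‖f‖` is the supremum norm
(`IsMarkovChain.integral_mul_le`). Summing the geometric series, the second moment of the sum of
`n` terms is at most `6 n ‖f‖² / (1 - β) = 12 n ‖f‖² / φ²`, so that the mean square error is at
most `12 ‖f‖² / (n φ²)`, well below the claimed `100 ‖f‖² / (n φ²)`.

If `φ = ∞`, then Cheeger's inequality and positivity force `g = 0` almost everywhere and the error
vanishes; if `φ = 0`, the bounds are infinite unless `f = 0` almost everywhere.
-/


/-! ### Bounded measurable functions -/

/-- A real function that is measurable and bounded everywhere (not merely almost everywhere). Such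
functions are integrable against every finite measure and are stable under the transition
operator, so that no integrability question arises for them. -/
structure BddMeasurable {α : Type*} [MeasurableSpace α] (h : α → ℝ) : Prop where
  measurable : Measurable h
  bdd : ∃ C, ∀ x, |h x| ≤ C

namespace BddMeasurable

variable {α β : Type*} [MeasurableSpace α] [MeasurableSpace β] {g h : α → ℝ}

lemma const (c : ℝ) : BddMeasurable (fun _ : α => c) :=
  ⟨measurable_const, |c|, fun _ => le_rfl⟩

lemma add (hg : BddMeasurable g) (hh : BddMeasurable h) :
    BddMeasurable (fun x => g x + h x) := by
  obtain ⟨C, hC⟩ := hg.bdd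
  obtain ⟨D, hD⟩ := hh.bdd
  exact ⟨hg.measurable.add hh.measurable, C + D,
    fun x => (abs_add_le _ _).trans (add_le_add (hC x) (hD x))⟩

lemma mul (hg : BddMeasurable g) (hh : BddMeasurable h) :
    BddMeasurable (fun x => g x * h x) := by
  obtain ⟨C, hC⟩ := hg.bdd
  obtain ⟨D, hD⟩ := hh.bdd
  refine ⟨hg.measurable.mul hh.measurable, C * D, fun x => ?_⟩
  rw [abs_mul]
  exact mul_le_mul (hC x) (hD x) (abs_nonneg _) ((abs_nonneg _).trans (hC x))

lemma sub (hg : BddMeasurable g) (hh : BddMeasurable h) :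
    BddMeasurable (fun x => g x - h x) := by
  simpa [sub_eq_add_neg] using hg.add ((const (-1)).mul hh)

lemma sq (hg : BddMeasurable g) : BddMeasurable (fun x => g x ^ 2) := by
  simpa [pow_two] using hg.mul hg

lemma abs (hg : BddMeasurable g) : BddMeasurable (fun x => |g x|) := by
  obtain ⟨C, hC⟩ := hg.bdd
  exact ⟨hg.measurable.abs, C, fun x => by simpa using hC x⟩

lemma max_zero (hg : BddMeasurable g) : BddMeasurable (fun x => max (g x) 0) := by
  obtain ⟨C, hC⟩ := hg.bdd
  refine ⟨hg.measurable.max measurable_const, C, fun x => ?_⟩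
  rw [abs_of_nonneg (le_max_right _ _)]
  exact max_le ((le_abs_self _).trans (hC x)) ((abs_nonneg _).trans (hC x))

lemma comp (hg : BddMeasurable g) {k : β → α} (hk : Measurable k) :
    BddMeasurable (fun x => g (k x)) :=
  ⟨hg.measurable.comp hk, hg.bdd.imp fun _ hC x => hC (k x)⟩

lemma indicator_one {A : Set α} (hA : MeasurableSet A) :
    BddMeasurable (A.indicator (fun _ => (1 : ℝ))) := by
  refine ⟨measurable_const.indicator hA, 1, fun x => ?_⟩
  by_cases hx : x ∈ A <;> simp [hx]

lemma integrable (hg : BddMeasurable g) (μ : Measure α) [IsFiniteMeasure μ] :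
    Integrable g μ := by
  obtain ⟨C, hC⟩ := hg.bdd
  exact Integrable.of_bound hg.measurable.aestronglyMeasurable C (Filter.Eventually.of_forall hC)

lemma integrable_comp (hg : BddMeasurable g) {P : Measure β} [IsFiniteMeasure P] {k : β → α}
    (hk : AEMeasurable k P) : Integrable (fun ω => g (k ω)) P := by
  obtain ⟨C, hC⟩ := hg.bdd
  exact Integrable.of_bound (hg.measurable.comp_aemeasurable hk).aestronglyMeasurable C
    (Filter.Eventually.of_forall fun ω => hC (k ω))

/-- The Cauchy–Schwarz inequality. -/
lemma sq_integral_mul_le (hg : BddMeasurable g) (hh : BddMeasurable h)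
    (μ : Measure α) [IsFiniteMeasure μ] :
    (∫ x, g x * h x ∂μ) ^ 2 ≤ (∫ x, g x ^ 2 ∂μ) * ∫ x, h x ^ 2 ∂μ := by
  -- The quadratic polynomial `t ↦ ∫ (t g + h)²` is nonnegative.
  have key : ∀ t : ℝ, 0 ≤ (∫ x, g x ^ 2 ∂μ) * (t * t) + (2 * ∫ x, g x * h x ∂μ) * t
      + ∫ x, h x ^ 2 ∂μ := by
    intro t
    have h0 : 0 ≤ ∫ x, (t * g x + h x) ^ 2 ∂μ := integral_nonneg fun x => sq_nonneg _
    have h1 : ∫ x, (t * g x + h x) ^ 2 ∂μ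
        = ∫ x, (t * t) * g x ^ 2 + (2 * t) * (g x * h x) + h x ^ 2 ∂μ :=
      integral_congr_ae (Filter.Eventually.of_forall fun x => by simp only; ring)
    rw [h1, integral_add, integral_add, integral_const_mul, integral_const_mul] at h0
    · linarith
    · exact (hg.sq.integrable μ).const_mul _
    · exact ((hg.mul hh).integrable μ).const_mul _
    · exact ((hg.sq.integrable μ).const_mul _).add (((hg.mul hh).integrable μ).const_mul _)
    · exact hh.sq.integrable μ
  have := discrim_le_zero key
  rw [discrim] at this
  linarith

end BddMeasurable

/-! ### The transition operator -/

section Transition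

variable {Ω : Type*} [MeasurableSpace Ω] (K : Kernel Ω Ω)

/-- The transition operator `(Ph)(x) = ∫ h(y) K(x,dy)` of a kernel, acting on functions. -/
noncomputable def transOp (h : Ω → ℝ) (x : Ω) : ℝ := ∫ y, h y ∂K x

variable {K} {π : Measure Ω} {g h : Ω → ℝ}

lemma abs_transOp_le [IsMarkovKernel K] {C : ℝ} (hC : ∀ x, |h x| ≤ C) (x : Ω) :
    |transOp K h x| ≤ C := by
  have := norm_integral_le_of_norm_le_const (μ := K x) (f := h)
    (Filter.Eventually.of_forall hC)
  simpa [transOp] using this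

lemma BddMeasurable.transOp [IsMarkovKernel K] (hh : BddMeasurable h) :
    BddMeasurable (transOp K h) :=
  ⟨(hh.measurable.stronglyMeasurable.integral_kernel (κ := K)).measurable,
    hh.bdd.imp fun _ hC => abs_transOp_le hC⟩

lemma BddMeasurable.transOp_iterate [IsMarkovKernel K] (hh : BddMeasurable h) (n : ℕ) :
    BddMeasurable ((_root_.transOp K)^[n] h) := by
  induction n with
  | zero => exact hh
  | succ n ih => rw [Function.iterate_succ_apply']; exact ih.transOp

lemma transOp_sub [IsMarkovKernel K] (hg : BddMeasurable g) (hh : BddMeasurable h) :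
    transOp K (fun x => g x - h x) = fun x => transOp K g x - transOp K h x :=
  funext fun x => integral_sub (hg.integrable (K x)) (hh.integrable (K x))

lemma transOp_const [IsMarkovKernel K] (c : ℝ) :
    transOp K (fun _ => c) = fun _ => c := by
  funext x
  simp [transOp]

lemma transOp_iterate_sub_const [IsMarkovKernel K] (hg : BddMeasurable g) (c : ℝ) (n : ℕ) :
    (transOp K)^[n] (fun x => g x - c) = fun x => (transOp K)^[n] g x - c := by
  induction n with
  | zero => rfl
  | succ n ih =>
    rw [Function.iterate_succ_apply', Function.iterate_succ_apply', ih,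
      transOp_sub (hg.transOp_iterate n) (.const c), transOp_const]

lemma half_smul_dirac_le (hlazy : IsLazy K) (x : Ω) : (1 / 2 : ℝ≥0∞) • Measure.dirac x ≤ K x := by
  refine Measure.le_iff.2 fun s hs => ?_
  rw [Measure.smul_apply, Measure.dirac_apply' x hs, smul_eq_mul]
  by_cases hx : x ∈ s
  · simpa [hx] using (hlazy x).trans (measure_mono (Set.singleton_subset_iff.2 hx))
  · simp [hx]

variable [IsMarkovKernel K] [IsProbabilityMeasure π]

lemma integral_compProd_mul (hg : BddMeasurable g) (hh : BddMeasurable h) :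
    ∫ z, g z.1 * h z.2 ∂(π ⊗ₘ K) = ∫ x, g x * transOp K h x ∂π := by
  rw [Measure.integral_compProd
    (((hg.comp measurable_fst).mul (hh.comp measurable_snd)).integrable _)]
  simp only [integral_const_mul, transOp]

/-- Reversibility of `K` makes the law of two consecutive states of the stationary chain
symmetric. -/
lemma map_swap_compProd (hrev : K.IsReversible π) :
    (π ⊗ₘ K).map Prod.swap = π ⊗ₘ K := by
  have : IsProbabilityMeasure ((π ⊗ₘ K).map Prod.swap) :=
    Measure.isProbabilityMeasure_map measurable_swap.aemeasurable
  refine Measure.ext_prod fun {s t} hs ht => ?_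
  rw [Measure.map_apply measurable_swap (hs.prod ht), Set.preimage_swap_prod,
    Measure.compProd_apply_prod ht hs, Measure.compProd_apply_prod hs ht]
  exact hrev ht hs

lemma integral_compProd_swap (hrev : K.IsReversible π) {F : Ω × Ω → ℝ} (hF : BddMeasurable F) :
    ∫ z, F z.swap ∂(π ⊗ₘ K) = ∫ z, F z ∂(π ⊗ₘ K) := by
  conv_rhs => rw [← map_swap_compProd hrev]
  rw [integral_map measurable_swap.aemeasurable hF.measurable.aestronglyMeasurable]

/-- The transition operator of a reversible kernel is symmetric. -/
lemma integral_mul_transOp_comm (hrev : K.IsReversible π)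
    (hg : BddMeasurable g) (hh : BddMeasurable h) :
    ∫ x, g x * transOp K h x ∂π = ∫ x, transOp K g x * h x ∂π := by
  rw [← integral_compProd_mul hg hh, ← integral_compProd_swap hrev
    ((hg.comp measurable_fst).mul (hh.comp measurable_snd))]
  simp only [Prod.fst_swap, Prod.snd_swap, mul_comm (g _), mul_comm (transOp K g _)]
  exact integral_compProd_mul hh hg

lemma integral_mul_transOp_iterate_comm (hrev : K.IsReversible π)
    (hg : BddMeasurable g) (hh : BddMeasurable h) (n : ℕ) :
    ∫ x, g x * (transOp K)^[n] h x ∂π = ∫ x, (transOp K)^[n] g x * h x ∂π := by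
  induction n generalizing g with
  | zero => rfl
  | succ n ih =>
    rw [Function.iterate_succ_apply', integral_mul_transOp_comm hrev hg (hh.transOp_iterate n),
      ih hg.transOp, Function.iterate_succ_apply]

lemma integral_transOp (hrev : K.IsReversible π) (hh : BddMeasurable h) :
    ∫ x, transOp K h x ∂π = ∫ x, h x ∂π := by
  have := integral_mul_transOp_comm hrev (.const 1) hh
  rw [transOp_const] at this
  simpa using this

lemma integral_compProd_fst (hh : BddMeasurable h) :
    ∫ z, h z.1 ∂(π ⊗ₘ K) = ∫ x, h x ∂π := by
  have := integral_compProd_mul (K := K) (π := π) hh (.const 1)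
  rw [transOp_const] at this
  simpa using this

lemma integral_compProd_snd (hrev : K.IsReversible π) (hh : BddMeasurable h) :
    ∫ z, h z.2 ∂(π ⊗ₘ K) = ∫ x, h x ∂π := by
  rw [← integral_compProd_fst (K := K) hh, ← integral_compProd_swap hrev (hh.comp measurable_fst)]
  rfl

/-- For `s = -1` this is twice the Dirichlet form of `h`, for `s = 1` the companion form that the
Cauchy–Schwarz step of Cheeger's inequality and the positivity argument use. -/
lemma integral_compProd_add_sq (hrev : K.IsReversible π) (hh : BddMeasurable h) {s : ℝ}
    (hs : s ^ 2 = 1) :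
    ∫ z, (h z.1 + s * h z.2) ^ 2 ∂(π ⊗ₘ K)
      = 2 * ∫ x, h x ^ 2 ∂π + 2 * s * ∫ x, h x * transOp K h x ∂π := by
  have h1 : ∫ z, (h z.1 + s * h z.2) ^ 2 ∂(π ⊗ₘ K)
      = ∫ z, h z.1 ^ 2 + (2 * s) * (h z.1 * h z.2) + h z.2 ^ 2 ∂(π ⊗ₘ K) :=
    integral_congr_ae (Filter.Eventually.of_forall fun z => by
      simp only
      linear_combination (h z.2) ^ 2 * hs)
  have i1 := (hh.sq.comp measurable_fst).integrable (π ⊗ₘ K)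
  have i2 := (((BddMeasurable.const (2 * s)).mul
    ((hh.comp measurable_fst).mul (hh.comp measurable_snd)))).integrable (π ⊗ₘ K)
  have i3 := (hh.sq.comp measurable_snd).integrable (π ⊗ₘ K)
  have i12 : Integrable (fun z : Ω × Ω => h z.1 ^ 2 + 2 * s * (h z.1 * h z.2)) (π ⊗ₘ K) := i1.add i2
  rw [h1, integral_add i12 i3, integral_add i1 i2, integral_const_mul,
    integral_compProd_mul hh hh, integral_compProd_fst hh.sq, integral_compProd_snd hrev hh.sq]
  ring

/-- The transition operator of a lazy reversible kernel is positive semidefinite: since the chain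
stands still with probability at least `1/2`, the integral of `(h(x) + h(y))²` is at least half the
integral of `(2 h(x))²`. -/
lemma integral_mul_transOp_nonneg (hlazy : IsLazy K) (hrev : K.IsReversible π)
    (hh : BddMeasurable h) : 0 ≤ ∫ x, h x * transOp K h x ∂π := by
  have h1 := integral_compProd_add_sq hrev hh (s := 1) (by norm_num)
  have hb : BddMeasurable fun z : Ω × Ω => (h z.1 + 1 * h z.2) ^ 2 :=
    ((hh.comp measurable_fst).add ((BddMeasurable.const 1).mul (hh.comp measurable_snd))).sq
  have h2 : ∫ x, 2 * h x ^ 2 ∂π ≤ ∫ z, (h z.1 + 1 * h z.2) ^ 2 ∂(π ⊗ₘ K) := by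
    rw [Measure.integral_compProd (hb.integrable _)]
    have hi := ((Measure.integrable_compProd_iff hb.measurable.aestronglyMeasurable).1
      (hb.integrable (π ⊗ₘ K))).2
    simp only [Real.norm_of_nonneg (sq_nonneg _)] at hi
    refine integral_mono (((BddMeasurable.const 2).mul hh.sq).integrable π)
      hi fun x => ?_
    have hx : BddMeasurable fun y => (h x + 1 * h y) ^ 2 :=
      hb.comp (measurable_prodMk_left (x := x))
    have h3 : ∫ y, (h x + 1 * h y) ^ 2 ∂((1 / 2 : ℝ≥0∞) • Measure.dirac x)
        ≤ ∫ y, (h x + 1 * h y) ^ 2 ∂K x :=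
      integral_mono_measure (half_smul_dirac_le hlazy x)
        (Filter.Eventually.of_forall fun y => sq_nonneg _) (hx.integrable _)
    rw [integral_smul_measure, integral_dirac' _ _ hx.measurable.stronglyMeasurable] at h3
    refine le_trans (le_of_eq ?_) h3
    simp
    ring
  rw [integral_const_mul] at h2
  linarith

end Transition

/-! ### Cheeger's inequality -/

/-- Every real random variable has a median. -/
lemma exists_median {Ω : Type*} [MeasurableSpace Ω] (π : Measure Ω) [IsProbabilityMeasure π]
    {g : Ω → ℝ} (hg : Measurable g) :
    ∃ m : ℝ, π {x | m < g x} ≤ 1 / 2 ∧ π {x | g x < m} ≤ 1 / 2 := by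
  have hρ : IsProbabilityMeasure (π.map g) := Measure.isProbabilityMeasure_map hg.aemeasurable
  set ρ := π.map g
  -- The median is the smallest point at which the distribution function reaches `1/2`.
  set S : Set ℝ := {t | 1 / 2 ≤ cdf ρ t}
  have hne : S.Nonempty :=
    ((tendsto_cdf_atTop ρ).eventually (eventually_ge_nhds (by norm_num : (1 / 2 : ℝ) < 1))).exists
  have hbdd : BddBelow S := by
    obtain ⟨b, hb⟩ := ((tendsto_cdf_atBot ρ).eventually
      (eventually_lt_nhds (by norm_num : (0 : ℝ) < 1 / 2))).exists
    exact ⟨b, fun t ht => le_of_not_gt fun hlt =>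
      absurd (ht.trans (monotone_cdf ρ hlt.le)) (not_le.2 hb)⟩
  have hm : 1 / 2 ≤ cdf ρ (sInf S) := by
    have hr : Filter.Tendsto (cdf ρ) (nhdsWithin (sInf S) (Set.Ioi (sInf S)))
        (nhds (cdf ρ (sInf S))) :=
      ((cdf ρ).right_continuous (sInf S)).mono_left (nhdsWithin_mono _ Set.Ioi_subset_Ici_self)
    refine ge_of_tendsto hr ?_
    filter_upwards [self_mem_nhdsWithin] with t ht
    obtain ⟨s, hs, hst⟩ := exists_lt_of_csInf_lt hne ht
    exact hs.trans (monotone_cdf ρ hst.le)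
  refine ⟨sInf S, ?_, ?_⟩
  · have h1 : π {x | sInf S < g x} = ρ (Set.Iic (sInf S))ᶜ := by
      rw [Set.compl_Iic, Measure.map_apply hg measurableSet_Ioi]
      rfl
    rw [h1, prob_compl_eq_one_sub measurableSet_Iic, ← ofReal_cdf ρ]
    refine tsub_le_iff_right.2 ?_
    calc (1 : ℝ≥0∞) = 1 / 2 + ENNReal.ofReal (1 / 2) := by
          rw [ENNReal.ofReal_div_of_pos (by norm_num)]
          simp [ENNReal.inv_two_add_inv_two]
      _ ≤ _ := by gcongr
  · have h1 : π {x | g x < sInf S} = ρ (Set.Iio (sInf S)) := by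
      rw [Measure.map_apply hg measurableSet_Iio]
      rfl
    obtain ⟨u, hu, hlt, htend⟩ := exists_seq_strictMono_tendsto (sInf S)
    have hU : Set.Iio (sInf S) = ⋃ n, Set.Iic (u n) :=
      (iUnion_Iic_eq_Iio_of_lt_of_tendsto hlt htend).symm
    rw [h1, hU, Monotone.measure_iUnion fun a b hab => Set.Iic_subset_Iic.2 (hu.monotone hab)]
    refine iSup_le fun n => ?_
    rw [← ofReal_cdf ρ]
    have : cdf ρ (u n) < 1 / 2 := not_le.1 fun h => absurd (csInf_le hbdd h) (not_le.2 (hlt n))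
    refine (ENNReal.ofReal_le_ofReal this.le).trans (le_of_eq ?_)
    rw [ENNReal.ofReal_div_of_pos (by norm_num)]
    simp

section Cheeger

variable {Ω : Type*} [MeasurableSpace Ω] {K : Kernel Ω Ω} [IsMarkovKernel K]
  {π : Measure Ω} [IsProbabilityMeasure π] {g h u : Ω → ℝ} {c : ℝ}

lemma mul_le_compProd_of_le_conductance (hc : ENNReal.ofReal c ≤ conductance K π) {A : Set Ω}
    (hA : MeasurableSet A) (hA2 : π A ≤ 1 / 2) :
    ENNReal.ofReal c * π A ≤ (π ⊗ₘ K) (A ×ˢ Aᶜ) := by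
  rcases eq_or_ne (π A) 0 with h0 | h0
  · simp [h0]
  · have h1 : conductance K π ≤ (∫⁻ x in A, K x Aᶜ ∂π) / π A :=
      iInf_le_of_le A <| iInf_le_of_le hA <| iInf_le_of_le (pos_iff_ne_zero.2 h0) <|
        iInf_le_of_le hA2 le_rfl
    rw [Measure.compProd_apply_prod hA hA.compl]
    exact (ENNReal.le_div_iff_mul_le (Or.inl h0) (Or.inl (measure_ne_top _ _))).1 (hc.trans h1)

/-- The `L¹` form of Cheeger's inequality, in terms of positive parts. By the layer cake formula
both sides are integrals over the levels `t`, of the flow out of `{u > t}` and of the measure of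
`{u > t}`. -/
lemma mul_lintegral_le_lintegral_sub (hc : ENNReal.ofReal c ≤ conductance K π)
    (hu : Measurable u) (hu0 : ∀ x, 0 ≤ u x) (hhalf : π {x | 0 < u x} ≤ 1 / 2) :
    ENNReal.ofReal c * ∫⁻ x, ENNReal.ofReal (u x) ∂π
      ≤ ∫⁻ z, ENNReal.ofReal (u z.1 - u z.2) ∂(π ⊗ₘ K) := by
  have hmeas : MeasurableSet {p : (Ω × Ω) × ℝ | u p.1.2 ≤ p.2 ∧ p.2 < u p.1.1} :=
    (measurableSet_le (hu.comp (measurable_snd.comp measurable_fst)) measurable_snd).inter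
      (measurableSet_lt measurable_snd (hu.comp (measurable_fst.comp measurable_fst)))
  have h1 : ∀ z : Ω × Ω, ENNReal.ofReal (u z.1 - u z.2)
      = ∫⁻ t : ℝ, {p : (Ω × Ω) × ℝ | u p.1.2 ≤ p.2 ∧ p.2 < u p.1.1}.indicator 1 (z, t) := by
    intro z
    rw [← Real.volume_Ico, ← lintegral_indicator_one measurableSet_Ico]
    rfl
  simp_rw [h1]
  rw [lintegral_lintegral_swap (f := fun z t => Set.indicator _ 1 (z, t))
      ((measurable_one.indicator hmeas).aemeasurable),
    lintegral_eq_lintegral_meas_lt π (Filter.Eventually.of_forall hu0) hu.aemeasurable,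
    ← lintegral_const_mul' _ _ ENNReal.ofReal_ne_top]
  refine le_trans ?_ (setLIntegral_le_lintegral (Set.Ioi 0) _)
  refine setLIntegral_mono' measurableSet_Ioi fun t ht => ?_
  have hA : MeasurableSet {x | t < u x} := measurableSet_lt measurable_const hu
  have hsub : π {x | t < u x} ≤ 1 / 2 :=
    (measure_mono fun x (hx : t < u x) => lt_trans ht hx).trans hhalf
  refine (mul_le_compProd_of_le_conductance hc hA hsub).trans (le_of_eq ?_)
  rw [← lintegral_indicator_one (hA.prod hA.compl)]
  refine lintegral_congr fun z => ?_
  simp only [Set.indicator, Set.mem_prod, Set.mem_ofPred_eq, Set.mem_compl_iff, not_lt]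
  congr 1
  exact propext and_comm

/-- The `L¹` form of Cheeger's inequality. -/
lemma mul_integral_le_integral_abs_sub (hrev : K.IsReversible π)
    (hc0 : 0 ≤ c) (hc : ENNReal.ofReal c ≤ conductance K π)
    (hu : BddMeasurable u) (hu0 : ∀ x, 0 ≤ u x) (hhalf : π {x | 0 < u x} ≤ 1 / 2) :
    2 * c * ∫ x, u x ∂π ≤ ∫ z, |u z.1 - u z.2| ∂(π ⊗ₘ K) := by
  have hd : BddMeasurable fun z : Ω × Ω => u z.1 - u z.2 :=
    (hu.comp measurable_fst).sub (hu.comp measurable_snd)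
  have h1 := mul_lintegral_le_lintegral_sub hc hu.measurable hu0 hhalf
  have h2 : ∫⁻ z, ENNReal.ofReal (u z.1 - u z.2) ∂(π ⊗ₘ K)
      = ENNReal.ofReal (∫ z, max (u z.1 - u z.2) 0 ∂(π ⊗ₘ K)) := by
    rw [ofReal_integral_eq_lintegral_ofReal (hd.max_zero.integrable _)
      (Filter.Eventually.of_forall fun z => le_max_right _ _)]
    refine lintegral_congr fun z => ?_
    rcases le_total (u z.1 - u z.2) 0 with h | h
    · simp [h, ENNReal.ofReal_of_nonpos h]
    · simp [h]
  rw [h2, ← ofReal_integral_eq_lintegral_ofReal (hu.integrable _) (Filter.Eventually.of_forall hu0),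
    ← ENNReal.ofReal_mul hc0,
    ENNReal.ofReal_le_ofReal_iff (integral_nonneg fun z => by exact le_max_right _ _)] at h1
  have h3 : ∫ z, max (u z.2 - u z.1) 0 ∂(π ⊗ₘ K) = ∫ z, max (u z.1 - u z.2) 0 ∂(π ⊗ₘ K) :=
    integral_compProd_swap hrev hd.max_zero
  have h4 : ∫ z, |u z.1 - u z.2| ∂(π ⊗ₘ K)
      = ∫ z, max (u z.1 - u z.2) 0 ∂(π ⊗ₘ K) + ∫ z, max (u z.2 - u z.1) 0 ∂(π ⊗ₘ K) := by
    rw [← integral_add (hd.max_zero.integrable _)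
      (show Integrable (fun z : Ω × Ω => max (u z.2 - u z.1) 0) (π ⊗ₘ K) from
        (hd.max_zero.comp measurable_swap).integrable _)]
    refine integral_congr_ae (Filter.Eventually.of_forall fun z => ?_)
    simp only
    rcases le_total (u z.1) (u z.2) with h | h
    · rw [abs_of_nonpos (by linarith), max_eq_right (by linarith), max_eq_left (by linarith)]
      ring
    · rw [abs_of_nonneg (by linarith), max_eq_left (by linarith), max_eq_right (by linarith)]
      ring
  rw [h4, h3]
  linarith

/-- Cheeger's inequality for nonnegative functions supported on at most half of the space: the
`L¹` inequality is applied to `h²`, and `|h(x)² - h(y)²| = |h(x) - h(y)| (h(x) + h(y))` is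
estimated by the Cauchy–Schwarz inequality. -/
lemma integral_mul_transOp_le_of_nonneg (hrev : K.IsReversible π)
    (hc0 : 0 ≤ c) (hc : ENNReal.ofReal c ≤ conductance K π)
    (hh : BddMeasurable h) (hh0 : ∀ x, 0 ≤ h x) (hhalf : π {x | 0 < h x} ≤ 1 / 2) :
    ∫ x, h x * transOp K h x ∂π ≤ (1 - c ^ 2 / 2) * ∫ x, h x ^ 2 ∂π := by
  have hhalf' : π {x | 0 < h x ^ 2} ≤ 1 / 2 := by
    refine (measure_mono fun x (hx : 0 < h x ^ 2) => ?_).trans hhalf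
    exact lt_of_le_of_ne (hh0 x) fun h0 => by simp [← h0] at hx
  have h1 := mul_integral_le_integral_abs_sub hrev hc0 hc hh.sq (fun x => sq_nonneg _) hhalf'
  have hm : BddMeasurable fun z : Ω × Ω => h z.1 + -1 * h z.2 :=
    (hh.comp measurable_fst).add ((BddMeasurable.const (-1)).mul (hh.comp measurable_snd))
  have hp : BddMeasurable fun z : Ω × Ω => h z.1 + 1 * h z.2 :=
    (hh.comp measurable_fst).add ((BddMeasurable.const 1).mul (hh.comp measurable_snd))
  have h2 := hm.abs.sq_integral_mul_le hp (π ⊗ₘ K)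
  have h3 : ∀ z : Ω × Ω, |h z.1 ^ 2 - h z.2 ^ 2| = |h z.1 + -1 * h z.2| * (h z.1 + 1 * h z.2) := by
    intro z
    have : 0 ≤ h z.1 + 1 * h z.2 := by linarith [hh0 z.1, hh0 z.2]
    rw [show h z.1 ^ 2 - h z.2 ^ 2 = (h z.1 + -1 * h z.2) * (h z.1 + 1 * h z.2) by ring, abs_mul,
      abs_of_nonneg this]
  simp only [sq_abs] at h2
  simp only [h3] at h1
  rw [integral_compProd_add_sq hrev hh (by norm_num),
    integral_compProd_add_sq hrev hh (by norm_num)] at h2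
  set A := ∫ x, h x ^ 2 ∂π
  set B := ∫ x, h x * transOp K h x ∂π
  have hA : 0 ≤ A := integral_nonneg fun x => sq_nonneg _
  have h4 : (2 * c * A) ^ 2 ≤ 4 * (A ^ 2 - B ^ 2) := by
    have := pow_le_pow_left₀ (by positivity) h1 2
    nlinarith
  rcases hA.eq_or_lt with h0 | hpos
  · rw [← h0] at h4 ⊢
    nlinarith
  · have hc1 : c ^ 2 ≤ 1 := by
      have : (c ^ 2) * A ^ 2 ≤ 1 * A ^ 2 := by nlinarith [sq_nonneg B]
      exact le_of_mul_le_mul_right this (by positivity)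
    refine le_of_abs_le (abs_le_of_sq_le_sq ?_ (mul_nonneg (by linarith) hA))
    nlinarith [mul_nonneg (sq_nonneg (c ^ 2)) (sq_nonneg A)]

/-- Cheeger's inequality: conductance at least `c` forces a spectral gap of at least `c²/2`
on functions of mean zero. Splitting `g` at a median reduces the
claim to functions supported on at most half of the space. -/
lemma integral_mul_transOp_le (hrev : K.IsReversible π)
    (hc0 : 0 ≤ c) (hc : ENNReal.ofReal c ≤ conductance K π)
    (hg : BddMeasurable g) (hmean : ∫ x, g x ∂π = 0) :
    ∫ x, g x * transOp K g x ∂π ≤ (1 - c ^ 2 / 2) * ∫ x, g x ^ 2 ∂π := by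
  obtain ⟨m, hm1, hm2⟩ := exists_median π hg.measurable
  have hp : BddMeasurable fun x => max (g x - m) 0 := (hg.sub (.const m)).max_zero
  have hn : BddMeasurable fun x => max (m - g x) 0 := ((BddMeasurable.const m).sub hg).max_zero
  have h1 := integral_mul_transOp_le_of_nonneg hrev hc0 hc hp (fun x => le_max_right _ _)
    (by simpa using hm1)
  have h2 := integral_mul_transOp_le_of_nonneg hrev hc0 hc hn (fun x => le_max_right _ _)
    (by simpa using hm2)
  have e0 := integral_compProd_add_sq hrev hg (s := -1) (by norm_num)
  have e1 := integral_compProd_add_sq hrev hp (s := -1) (by norm_num)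
  have e2 := integral_compProd_add_sq hrev hn (s := -1) (by norm_num)
  have hb : ∀ {k : Ω → ℝ}, BddMeasurable k →
      Integrable (fun z : Ω × Ω => (k z.1 + -1 * k z.2) ^ 2) (π ⊗ₘ K) := fun hk =>
    ((hk.comp measurable_fst).add
      ((BddMeasurable.const (-1)).mul (hk.comp measurable_snd))).sq.integrable _
  -- The Dirichlet form does not increase when `g - m` is split into its two parts.
  have h3 := integral_mono ((hb hp).add (hb hn)) (hb hg) fun z => by
    simp only [Pi.add_apply]
    rcases le_total (g z.1) m with ha | ha <;> rcases le_total (g z.2) m with hb | hb <;>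
    simp only [max_eq_left, max_eq_right, sub_nonneg, sub_nonpos, ha, hb] <;>
    nlinarith [mul_nonneg (sub_nonneg.2 ha) (sub_nonneg.2 hb)]
  rw [integral_add' (hb hp) (hb hn)] at h3
  have h4 : ∫ x, max (g x - m) 0 ^ 2 ∂π + ∫ x, max (m - g x) 0 ^ 2 ∂π
      = ∫ x, g x ^ 2 ∂π + m ^ 2 := by
    rw [← integral_add (hp.sq.integrable _) (hn.sq.integrable _)]
    have : ∀ x, max (g x - m) 0 ^ 2 + max (m - g x) 0 ^ 2 = g x ^ 2 + (m ^ 2 - 2 * m * g x) := by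
      intro x
      rcases le_total (g x) m with h | h <;> simp [h] <;> ring
    simp only [this]
    rw [integral_add (hg.sq.integrable _) (((BddMeasurable.const _).sub
      ((BddMeasurable.const _).mul hg)).integrable _), integral_sub (integrable_const _)
      (((BddMeasurable.const _).mul hg).integrable _), integral_const_mul, hmean]
    simp
  nlinarith [mul_nonneg (sq_nonneg c) (sq_nonneg m)]

/-- A lazy reversible transition operator with conductance at least `c` contracts mean-zero
functions in `L²(π)` by the factor `1 - c²/2`. Positive semidefiniteness turns the bound on the
quadratic form into a bound on the operator norm. -/
lemma integral_transOp_sq_le (hlazy : IsLazy K) (hrev : K.IsReversible π)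
    (hc0 : 0 ≤ c) (hc1 : c ≤ 1) (hc : ENNReal.ofReal c ≤ conductance K π)
    (hg : BddMeasurable g) (hmean : ∫ x, g x ∂π = 0) :
    ∫ x, transOp K g x ^ 2 ∂π ≤ (1 - c ^ 2 / 2) ^ 2 * ∫ x, g x ^ 2 ∂π := by
  obtain ⟨β, hβdef⟩ : ∃ β, β = 1 - c ^ 2 / 2 := ⟨_, rfl⟩
  have hβ : 0 < β := by nlinarith
  have hT : BddMeasurable (transOp K g) := hg.transOp
  have hTT : BddMeasurable (transOp K (transOp K g)) := hT.transOp
  have ha := integral_mul_transOp_le hrev hc0 hc hg hmean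
  have hb := integral_mul_transOp_le (g := transOp K g) hrev hc0 hc hT
    ((integral_transOp hrev hg).trans hmean)
  rw [← hβdef] at ha hb ⊢
  -- Positivity of the form at `β g - P g`.
  have hpos := integral_mul_transOp_nonneg hlazy hrev (((BddMeasurable.const β).mul hg).sub hT)
  have e1 : ∫ x, g x * transOp K (transOp K g) x ∂π = ∫ x, transOp K g x ^ 2 ∂π := by
    rw [integral_mul_transOp_comm hrev hg hT]
    simp only [pow_two]
  have e2 : transOp K (fun x => β * g x - transOp K g x)
      = fun x => β * transOp K g x - transOp K (transOp K g) x := by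
    rw [transOp_sub ((BddMeasurable.const β).mul hg) hT]
    simp only [transOp, integral_const_mul]
  have e3 : ∫ x, (β * g x - transOp K g x) * (β * transOp K g x - transOp K (transOp K g) x) ∂π
      = β ^ 2 * ∫ x, g x * transOp K g x ∂π - β * ∫ x, transOp K g x ^ 2 ∂π
        - β * ∫ x, g x * transOp K (transOp K g) x ∂π
        + ∫ x, transOp K g x * transOp K (transOp K g) x ∂π := by
    have b1 := (BddMeasurable.const (β ^ 2)).mul (hg.mul hT)
    have b2 := (BddMeasurable.const β).mul hT.sq
    have b3 := (BddMeasurable.const β).mul (hg.mul hTT)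
    have b4 := hT.mul hTT
    simp only [← integral_const_mul]
    rw [← integral_sub (b1.integrable π) (b2.integrable π),
      ← integral_sub ((b1.sub b2).integrable π) (b3.integrable π),
      ← integral_add (((b1.sub b2).sub b3).integrable π) (b4.integrable π)]
    refine integral_congr_ae (Filter.Eventually.of_forall fun x => ?_)
    simp only
    ring
  rw [e2, e3, e1] at hpos
  have ha' := mul_le_mul_of_nonneg_left ha (sq_nonneg β)
  set s := ∫ x, transOp K g x ^ 2 ∂π
  have h5 : β * s ≤ β * (β ^ 2 * ∫ x, g x ^ 2 ∂π) := by linarith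
  exact le_of_mul_le_mul_left h5 hβ

lemma integral_transOp_iterate_sq_le (hlazy : IsLazy K) (hrev : K.IsReversible π)
    (hc0 : 0 ≤ c) (hc1 : c ≤ 1) (hc : ENNReal.ofReal c ≤ conductance K π)
    (hg : BddMeasurable g) (hmean : ∫ x, g x ∂π = 0) (n : ℕ) :
    ∫ x, (transOp K)^[n] g x ^ 2 ∂π ≤ ((1 - c ^ 2 / 2) ^ n) ^ 2 * ∫ x, g x ^ 2 ∂π := by
  have key : ∫ x, (transOp K)^[n] g x ∂π = 0 ∧
      ∫ x, (transOp K)^[n] g x ^ 2 ∂π ≤ ((1 - c ^ 2 / 2) ^ n) ^ 2 * ∫ x, g x ^ 2 ∂π := by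
    induction n with
    | zero => simpa using hmean
    | succ n ih =>
      rw [Function.iterate_succ_apply']
      have hn := hg.transOp_iterate (K := K) n
      refine ⟨(integral_transOp hrev hn).trans ih.1, ?_⟩
      refine (integral_transOp_sq_le hlazy hrev hc0 hc1 hc hn ih.1).trans ?_
      refine (mul_le_mul_of_nonneg_left ih.2 (sq_nonneg _)).trans (le_of_eq ?_)
      ring
  exact key.2

/-- A lazy reversible chain has conductance at least `2` only if all functions of mean zero
vanish almost everywhere. -/
lemma integral_sq_eq_zero_of_two_le_conductance (hlazy : IsLazy K) (hrev : K.IsReversible π)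
    (hc : 2 ≤ conductance K π) (hg : BddMeasurable g) (hmean : ∫ x, g x ∂π = 0) :
    ∫ x, g x ^ 2 ∂π = 0 := by
  have h1 := integral_mul_transOp_le hrev (c := 2) (by norm_num) (by simpa using hc) hg hmean
  have h2 := integral_mul_transOp_nonneg hlazy hrev hg
  have h3 : 0 ≤ ∫ x, g x ^ 2 ∂π := integral_nonneg fun x => sq_nonneg _
  linarith

end Cheeger

/-! ### Bounded densities and the law of the chain -/

section Density

variable {Ω : Type*} [MeasurableSpace Ω] {π ν : Measure Ω} [IsProbabilityMeasure π]
  [IsProbabilityMeasure ν]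

/-- A measure with bounded density has a version of its density that is bounded everywhere by the
essential supremum. -/
lemma exists_bddMeasurable_density (hνπ : ν ≪ π) (hbdd : densityNorm ν π < ∞) :
    ∃ D : Ω → ℝ, BddMeasurable D ∧ (∀ x, 0 ≤ D x) ∧ (∀ x, D x ≤ (densityNorm ν π).toReal) ∧
      ∀ h : Ω → ℝ, ∫ x, h x ∂ν = ∫ x, D x * h x ∂π := by
  have hle : ∀ x, (min (ν.rnDeriv π x) (densityNorm ν π)).toReal ≤ (densityNorm ν π).toReal :=
    fun x => ENNReal.toReal_mono hbdd.ne (min_le_right _ _)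
  refine ⟨fun x => (min (ν.rnDeriv π x) (densityNorm ν π)).toReal,
    ⟨?_, (densityNorm ν π).toReal, fun x => ?_⟩, fun x => ENNReal.toReal_nonneg, hle, fun h => ?_⟩
  · exact ((Measure.measurable_rnDeriv ν π).min measurable_const).ennreal_toReal
  · rw [abs_of_nonneg ENNReal.toReal_nonneg]
    exact hle x
  · rw [← integral_rnDeriv_smul hνπ]
    refine integral_congr_ae ?_
    filter_upwards [ENNReal.ae_le_essSup (μ := π) (ν.rnDeriv π)] with x hx
    rw [min_eq_left (show ν.rnDeriv π x ≤ densityNorm ν π from hx), smul_eq_mul]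

end Density

section Chain

variable {Ω Ω' : Type*} [MeasurableSpace Ω] [MeasurableSpace Ω'] {K : Kernel Ω Ω}
  [IsMarkovKernel K] {π ν : Measure Ω} [IsProbabilityMeasure π]
  {P : Measure Ω'} [IsProbabilityMeasure P] {X : ℕ → Ω' → Ω} {g h D : Ω → ℝ}

namespace IsMarkovChain

omit [IsMarkovKernel K] [IsProbabilityMeasure P] in
lemma aemeasurable (hX : IsMarkovChain X K ν P) (n : ℕ) : AEMeasurable (X n) P := by
  cases n with
  | zero => exact hX.initial.aemeasurable
  | succ n => exact (hX.step n).aemeasurable_snd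

lemma integral_mul_succ (hX : IsMarkovChain X K ν P) (hg : BddMeasurable g)
    (hh : BddMeasurable h) {j n : ℕ} (hj : j ≤ n) :
    ∫ ω, g (X j ω) * h (X (n + 1) ω) ∂P = ∫ ω, g (X j ω) * transOp K h (X n ω) ∂P := by
  have hs := hX.step n
  have hpast := hs.aemeasurable_fst
  have hp : IsProbabilityMeasure (P.map fun ω (i : Fin (n + 1)) => X i ω) :=
    Measure.isProbabilityMeasure_map hpast
  have hgj : BddMeasurable fun x : Fin (n + 1) → Ω => g (x ⟨j, Nat.lt_succ_of_le hj⟩) :=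
    hg.comp (measurable_pi_apply _)
  have hF : BddMeasurable fun z : (Fin (n + 1) → Ω) × Ω =>
      g (z.1 ⟨j, Nat.lt_succ_of_le hj⟩) * h z.2 :=
    (hgj.comp measurable_fst).mul (hh.comp measurable_snd)
  have hG : BddMeasurable fun x : Fin (n + 1) → Ω =>
      g (x ⟨j, Nat.lt_succ_of_le hj⟩) * transOp K h (x (Fin.last n)) :=
    hgj.mul (hh.transOp.comp (measurable_pi_apply _))
  have h1 := hs.integral_comp (f := fun z : (Fin (n + 1) → Ω) × Ω =>
    g (z.1 ⟨j, Nat.lt_succ_of_le hj⟩) * h z.2) hF.measurable.aestronglyMeasurable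
  refine h1.trans ?_
  rw [Measure.integral_compProd (hF.integrable _)]
  simp only [integral_const_mul, Kernel.comap_apply]
  exact integral_map hpast hG.measurable.aestronglyMeasurable

lemma integral_mul_add (hX : IsMarkovChain X K ν P) (hg : BddMeasurable g)
    (hh : BddMeasurable h) (j l : ℕ) :
    ∫ ω, g (X j ω) * h (X (j + l) ω) ∂P = ∫ ω, g (X j ω) * (transOp K)^[l] h (X j ω) ∂P := by
  induction l generalizing h with
  | zero => rfl
  | succ l ih =>
    rw [← Nat.add_assoc, hX.integral_mul_succ hg hh (Nat.le_add_right j l), ih hh.transOp,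
      Function.iterate_succ_apply]

/-- If `ν` has density `D` with respect to the reversible measure `π`, then the law of `X m` has
density `P^m D`. -/
lemma integral_apply (hX : IsMarkovChain X K ν P) (hrev : K.IsReversible π)
    (hD : BddMeasurable D) (hνD : ∀ h : Ω → ℝ, ∫ x, h x ∂ν = ∫ x, D x * h x ∂π)
    (hh : BddMeasurable h) (m : ℕ) :
    ∫ ω, h (X m ω) ∂P = ∫ x, (transOp K)^[m] D x * h x ∂π := by
  have h1 := hX.integral_mul_add (.const 1) hh 0 m
  simp only [one_mul, Nat.zero_add] at h1
  have h2 := hX.initial.integral_comp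
    (hh.transOp_iterate (K := K) m).measurable.aestronglyMeasurable
  rw [h1, ← integral_mul_transOp_iterate_comm hrev hD hh, ← hνD]
  exact h2

lemma map_absolutelyContinuous (hX : IsMarkovChain X K ν P) (hrev : K.IsReversible π)
    (hD : BddMeasurable D) (hνD : ∀ h : Ω → ℝ, ∫ x, h x ∂ν = ∫ x, D x * h x ∂π) (m : ℕ) :
    P.map (X m) ≪ π := by
  have : IsProbabilityMeasure (P.map (X m)) := Measure.isProbabilityMeasure_map (hX.aemeasurable m)
  refine Measure.AbsolutelyContinuous.mk fun s hs h0 => ?_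
  have hb := BddMeasurable.indicator_one hs
  have h1 := hX.integral_apply hrev hD hνD hb m
  rw [← integral_map (hX.aemeasurable m) hb.measurable.aestronglyMeasurable,
    integral_indicator hs] at h1
  have h2 : ∫ x, (transOp K)^[m] D x * s.indicator (fun _ => (1 : ℝ)) x ∂π = 0 := by
    refine integral_eq_zero_of_ae ?_
    filter_upwards [measure_eq_zero_iff_ae_notMem.1 h0] with x hx
    simp [hx]
  rw [h2] at h1
  simpa [measureReal_def, ENNReal.toReal_eq_zero_iff] using h1

/-- Correlations of a mean-zero observable along the chain decay geometrically once the law of the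
chain is close to `π` in `L²(π)`. Writing the density of `X m` as `1 + (P^m D - 1)`, the two
resulting integrals are estimated by the Cauchy–Schwarz inequality. -/
lemma integral_mul_le (hX : IsMarkovChain X K ν P) (hrev : K.IsReversible π)
    (hD : BddMeasurable D) (hνD : ∀ h : Ω → ℝ, ∫ x, h x ∂ν = ∫ x, D x * h x ∂π)
    (hg : BddMeasurable g) {F b : ℝ} (hb : 0 ≤ b) (hgF : ∀ x, |g x| ≤ 2 * F)
    (hg2 : ∫ x, g x ^ 2 ∂π ≤ F ^ 2) {m l : ℕ}
    (hm : ∫ x, ((transOp K)^[m] D x - 1) ^ 2 ∂π ≤ 1)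
    (hl : ∫ x, (transOp K)^[l] g x ^ 2 ∂π ≤ b ^ 2 * ∫ x, g x ^ 2 ∂π) :
    ∫ ω, g (X m ω) * g (X (m + l) ω) ∂P ≤ 3 * F ^ 2 * b := by
  have hT : BddMeasurable ((transOp K)^[l] g) := hg.transOp_iterate l
  have hTD : BddMeasurable fun x => (transOp K)^[m] D x - 1 := (hD.transOp_iterate m).sub (.const 1)
  have hw := hg.mul hT
  rw [hX.integral_mul_add hg hg, hX.integral_apply hrev hD hνD hw]
  have h0 : ∫ x, (transOp K)^[m] D x * (g x * (transOp K)^[l] g x) ∂π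
      = ∫ x, g x * (transOp K)^[l] g x ∂π
        + ∫ x, ((transOp K)^[m] D x - 1) * (g x * (transOp K)^[l] g x) ∂π := by
    rw [← integral_add (hw.integrable π) ((hTD.mul hw).integrable π)]
    refine integral_congr_ae (Filter.Eventually.of_forall fun x => ?_)
    simp only
    ring
  have hl' : ∫ x, (transOp K)^[l] g x ^ 2 ∂π ≤ b ^ 2 * F ^ 2 :=
    hl.trans (mul_le_mul_of_nonneg_left hg2 (sq_nonneg _))
  have hl0 : 0 ≤ ∫ x, (transOp K)^[l] g x ^ 2 ∂π := integral_nonneg fun x => sq_nonneg _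
  have h1 : ∫ x, g x * (transOp K)^[l] g x ∂π ≤ F ^ 2 * b := by
    refine le_of_abs_le (abs_le_of_sq_le_sq ((hg.sq_integral_mul_le hT π).trans ?_) (by positivity))
    exact (mul_le_mul hg2 hl' hl0 (sq_nonneg _)).trans (le_of_eq (by ring))
  have hw2 : ∫ x, (g x * (transOp K)^[l] g x) ^ 2 ∂π ≤ (2 * F) ^ 2 * (b ^ 2 * F ^ 2) := by
    refine le_trans ?_ (mul_le_mul_of_nonneg_left hl' (sq_nonneg _))
    rw [← integral_const_mul]
    refine integral_mono (hw.sq.integrable π) (hT.sq.integrable π |>.const_mul _) fun x => ?_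
    simp only
    rw [mul_pow]
    refine mul_le_mul_of_nonneg_right ?_ (sq_nonneg _)
    exact sq_le_sq.2 ((hgF x).trans (le_abs_self _))
  have h2 : ∫ x, ((transOp K)^[m] D x - 1) * (g x * (transOp K)^[l] g x) ∂π ≤ 2 * F ^ 2 * b := by
    refine le_of_abs_le (abs_le_of_sq_le_sq ((hTD.sq_integral_mul_le hw π).trans ?_)
      (by positivity))
    refine (mul_le_mul hm hw2 (integral_nonneg fun x => sq_nonneg _) zero_le_one).trans
      (le_of_eq (by ring))
  rw [h0]
  linarith

end IsMarkovChain

omit [IsProbabilityMeasure P] in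
/-- Second moments of sums of random variables with geometrically decaying correlations. -/
lemma integral_sum_sq_le {Y : ℕ → Ω' → ℝ}
    (hY : ∀ i j, Integrable (fun ω => Y i ω * Y j ω) P) {C β : ℝ}
    (hC : 0 ≤ C) (hβ0 : 0 ≤ β) (hβ1 : β < 1)
    (hcor : ∀ j l, ∫ ω, Y j ω * Y (j + l) ω ∂P ≤ C * β ^ l) (n : ℕ) :
    ∫ ω, (∑ j ∈ Finset.range n, Y j ω) ^ 2 ∂P ≤ n * (2 * C / (1 - β)) := by
  induction n with
  | zero => simp
  | succ n ih =>
    have hint : Integrable (fun ω => (∑ j ∈ Finset.range n, Y j ω) ^ 2) P := by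
      simp only [pow_two, Finset.sum_mul_sum]
      exact integrable_finsetSum _ fun i _ => integrable_finsetSum _ fun j _ => hY i j
    have hint2 : Integrable (fun ω => 2 * ∑ j ∈ Finset.range n, Y j ω * Y n ω) P :=
      (integrable_finsetSum _ fun j _ => hY j n).const_mul 2
    have hint3 : Integrable (fun ω => 2 * ∑ j ∈ Finset.range n, Y j ω * Y n ω + Y n ω * Y n ω) P :=
      hint2.add (hY n n)
    have h1 : ∫ ω, (∑ j ∈ Finset.range (n + 1), Y j ω) ^ 2 ∂P
        = ∫ ω, (∑ j ∈ Finset.range n, Y j ω) ^ 2 ∂P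
          + (2 * ∑ j ∈ Finset.range n, ∫ ω, Y j ω * Y n ω ∂P + ∫ ω, Y n ω * Y n ω ∂P) := by
      rw [← integral_finsetSum _ fun j _ => hY j n, ← integral_const_mul,
        ← integral_add hint2 (hY n n), ← integral_add hint hint3]
      refine integral_congr_ae (Filter.Eventually.of_forall fun ω => ?_)
      simp only [Finset.sum_range_succ, ← Finset.sum_mul]
      ring
    have h2 : ∀ j ∈ Finset.range n, ∫ ω, Y j ω * Y n ω ∂P ≤ C * β ^ (n - j) := fun j hj => by
      have := hcor j (n - j)
      rwa [Nat.add_sub_cancel' (Finset.mem_range.1 hj).le] at this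
    have h3 : ∫ ω, Y n ω * Y n ω ∂P ≤ C := by simpa using hcor n 0
    have h4 : ∑ j ∈ Finset.range (n + 1), C * β ^ (n - j) ≤ C / (1 - β) := by
      rw [← Finset.mul_sum, div_eq_mul_inv]
      refine mul_le_mul_of_nonneg_left ?_ hC
      have := Finset.sum_range_reflect (fun j => β ^ j) (n + 1)
      simp only [Nat.add_sub_cancel] at this
      rw [this, ← tsum_geometric_of_lt_one hβ0 hβ1]
      exact (summable_geometric_of_lt_one hβ0 hβ1).sum_le_tsum _ fun i _ => pow_nonneg hβ0 i
    rw [Finset.sum_range_succ] at h4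
    simp only [Nat.sub_self, pow_zero, mul_one] at h4
    rw [h1]
    have h5 := Finset.sum_le_sum h2
    push_cast
    have h6 : 2 * C / (1 - β) = 2 * (C / (1 - β)) := by ring
    rw [h6] at ih ⊢
    linarith

end Chain

/-! ### The root mean square error -/

section Error

variable {Ω Ω' : Type*} [MeasurableSpace Ω] [MeasurableSpace Ω'] {K : Kernel Ω Ω}
  [IsMarkovKernel K] {π ν : Measure Ω} [IsProbabilityMeasure π] [IsProbabilityMeasure ν]
  {P : Measure Ω'} [IsProbabilityMeasure P] {X : ℕ → Ω' → Ω} {f k D : Ω → ℝ}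

omit [IsProbabilityMeasure π] in
/-- An essentially bounded function has a version that is bounded everywhere by its essential
supremum norm. -/
lemma MeasureTheory.MemLp.exists_bddMeasurable (hf : MemLp f ∞ π) :
    ∃ k : Ω → ℝ, BddMeasurable k ∧ (∀ x, |k x| ≤ (eLpNorm f ∞ π).toReal) ∧ f =ᵐ[π] k := by
  set F := (eLpNorm f ∞ π).toReal
  have hF : 0 ≤ F := ENNReal.toReal_nonneg
  have hle : ∀ x, |max (-F) (min F (hf.1.mk f x))| ≤ F := fun x =>
    abs_le.2 ⟨le_max_left _ _, max_le (by linarith) (min_le_left _ _)⟩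
  refine ⟨fun x => max (-F) (min F (hf.1.mk f x)), ⟨?_, F, hle⟩, hle, ?_⟩
  · exact measurable_const.max (measurable_const.min hf.1.stronglyMeasurable_mk.measurable)
  · filter_upwards [hf.1.ae_eq_mk, ae_le_eLpNormEssSup (f := f) (μ := π)] with x h1 h2
    have h3 : |f x| ≤ F := by
      have := ENNReal.toReal_mono (by simpa using hf.2.ne) h2
      simpa [F] using this
    rw [← h1, min_eq_right (abs_le.1 h3).2, max_eq_right (abs_le.1 h3).1]

omit [IsProbabilityMeasure π] in
lemma conductance_le_one (h : conductance K π ≠ ∞) : conductance K π ≤ 1 := by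
  by_contra hlt
  refine h ?_
  simp only [conductance, iInf_eq_top]
  intro A hA h0 hA2
  refine absurd (show conductance K π ≤ 1 from iInf_le_of_le A <| iInf_le_of_le hA <|
    iInf_le_of_le h0 <| iInf_le_of_le hA2 ?_) hlt
  refine ENNReal.div_le_of_le_mul ?_
  rw [one_mul]
  calc ∫⁻ x in A, K x Aᶜ ∂π ≤ ∫⁻ _ in A, 1 ∂π := lintegral_mono fun x => prob_le_one
    _ = π A := by simp

omit [IsMarkovKernel K] [IsProbabilityMeasure π] [IsProbabilityMeasure ν] in
/-- The mean square error in terms of a bounded version `k` of `f`. -/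
lemma mcmcError_le (hX : IsMarkovChain X K ν P) (hac : ∀ m, P.map (X m) ≪ π)
    (hk : BddMeasurable k) (hfk : f =ᵐ[π] k) {n n₀ : ℕ} (hn : 1 ≤ n) {B : ℝ} (hB : 0 ≤ B)
    (h : ∫ ω, (∑ j ∈ Finset.range n, (k (X (j + n₀) ω) - ∫ x, k x ∂π)) ^ 2 ∂P ≤ (n * B) ^ 2) :
    mcmcError X P π n n₀ f ≤ ENNReal.ofReal B := by
  have hn0 : (0 : ℝ) < n := by exact_mod_cast hn
  have hae : ∀ᵐ ω ∂P, ∀ j, f (X j ω) = k (X j ω) :=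
    ae_all_iff.2 fun j => ae_of_ae_map (hX.aemeasurable j) ((hac j).ae_le hfk)
  have hint : Integrable
      (fun ω => (∑ j ∈ Finset.range n, (k (X (j + n₀) ω) - ∫ x, k x ∂π)) ^ 2) P := by
    simp only [pow_two, Finset.sum_mul_sum]
    refine integrable_finsetSum _ fun i _ => integrable_finsetSum _ fun j _ => ?_
    have hb := hk.sub (.const (∫ x, k x ∂π))
    exact ((hb.comp measurable_fst).mul (hb.comp measurable_snd)).integrable_comp
      ((hX.aemeasurable (i + n₀)).prodMk (hX.aemeasurable (j + n₀)))
  have h1 : ∫⁻ ω, ‖mcmcEstimator X n n₀ f ω - ∫ x, f x ∂π‖ₑ ^ 2 ∂P ≤ ENNReal.ofReal (B ^ 2) := by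
    calc ∫⁻ ω, ‖mcmcEstimator X n n₀ f ω - ∫ x, f x ∂π‖ₑ ^ 2 ∂P
        = ∫⁻ ω, ENNReal.ofReal ((1 / (n : ℝ)) ^ 2
            * (∑ j ∈ Finset.range n, (k (X (j + n₀) ω) - ∫ x, k x ∂π)) ^ 2) ∂P := by
          refine lintegral_congr_ae ?_
          filter_upwards [hae] with ω hω
          rw [← mul_pow, ← sq_abs, ENNReal.ofReal_pow (abs_nonneg _), ← Real.norm_eq_abs,
            ofReal_norm, integral_congr_ae hfk, mcmcEstimator]
          simp only [hω, Finset.sum_sub_distrib, Finset.sum_const, Finset.card_range,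
            nsmul_eq_mul]
          congr 2
          field_simp
      _ = ENNReal.ofReal ((1 / (n : ℝ)) ^ 2
            * ∫ ω, (∑ j ∈ Finset.range n, (k (X (j + n₀) ω) - ∫ x, k x ∂π)) ^ 2 ∂P) := by
          rw [← integral_const_mul, ofReal_integral_eq_lintegral_ofReal (hint.const_mul _)]
          exact Filter.Eventually.of_forall fun ω => by positivity
      _ ≤ ENNReal.ofReal (B ^ 2) := by
          refine ENNReal.ofReal_le_ofReal ?_
          refine (mul_le_mul_of_nonneg_left h (sq_nonneg _)).trans (le_of_eq ?_)
          field_simp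
  calc mcmcError X P π n n₀ f ≤ ENNReal.ofReal (B ^ 2) ^ (1 / 2 : ℝ) :=
        ENNReal.rpow_le_rpow h1 (by norm_num)
    _ = ENNReal.ofReal B := by
        rw [ENNReal.ofReal_rpow_of_nonneg (sq_nonneg _) (by norm_num), ← Real.sqrt_eq_rpow,
          Real.sqrt_sq hB]

omit [IsMarkovKernel K] [IsProbabilityMeasure ν] in
lemma mcmcError_eq_zero (hX : IsMarkovChain X K ν P) (hac : ∀ m, P.map (X m) ≪ π)
    (hk : BddMeasurable k) (hfk : f =ᵐ[π] k) {n n₀ : ℕ} (hn : 1 ≤ n)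
    (h : ∫ x, (k x - ∫ y, k y ∂π) ^ 2 ∂π = 0) :
    mcmcError X P π n n₀ f = 0 := by
  have h0 : ∀ᵐ x ∂π, k x - ∫ y, k y ∂π = 0 := by
    filter_upwards [(integral_eq_zero_iff_of_nonneg (fun x => sq_nonneg _)
      ((hk.sub (.const _)).sq.integrable π)).1 h] with x hx
    simpa using hx
  have hae : ∀ᵐ ω ∂P, ∀ j, k (X j ω) - ∫ y, k y ∂π = 0 :=
    ae_all_iff.2 fun j => ae_of_ae_map (hX.aemeasurable j) ((hac j).ae_le h0)
  have := mcmcError_le hX hac hk hfk (n₀ := n₀) hn le_rfl (le_of_eq (by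
    rw [mul_zero, zero_pow two_ne_zero]
    refine integral_eq_zero_of_ae ?_
    filter_upwards [hae] with ω hω
    simp [hω]))
  simpa using this

/-- After the burn-in time the density of the chain is within distance one of the constant density
in `L²(π)`: with `M = ‖dν/dπ‖_∞` the initial distance is at most `√M`, and it has been contracted
`m` times by `1 - c²/2 ≤ exp(-c²/2)`. -/
lemma integral_transOp_iterate_density_sub_one_sq_le (hlazy : IsLazy K) (hrev : K.IsReversible π)
    {c : ℝ} (hc0 : 0 ≤ c) (hc1 : c ≤ 1) (hc : ENNReal.ofReal c ≤ conductance K π)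
    (hD : BddMeasurable D) (hD0 : ∀ x, 0 ≤ D x) {M : ℝ} (hDM : ∀ x, D x ≤ M)
    (hνD : ∀ h : Ω → ℝ, ∫ x, h x ∂ν = ∫ x, D x * h x ∂π) {m : ℕ} (hm : Real.log M ≤ m * c ^ 2) :
    ∫ x, ((transOp K)^[m] D x - 1) ^ 2 ∂π ≤ 1 := by
  have h1 : ∫ x, D x ∂π = 1 := by simpa using (hνD fun _ => 1).symm
  have hM : 1 ≤ M := by
    have := integral_mono (hD.integrable π) (integrable_const M) hDM
    simpa [h1] using this
  have h2 : ∫ x, (D x - 1) ^ 2 ∂π ≤ M := by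
    refine (integral_mono ((hD.sub (.const 1)).sq.integrable π)
      ((((BddMeasurable.const (M - 2)).mul hD).add (.const 1)).integrable π)
      fun x => ?_).trans ?_
    · simp only
      nlinarith [mul_nonneg (hD0 x) (sub_nonneg.2 (hDM x))]
    · rw [integral_add (((BddMeasurable.const _).mul hD).integrable π) (integrable_const _),
        integral_const_mul, h1]
      simp
      linarith
  have h3 := integral_transOp_iterate_sq_le hlazy hrev hc0 hc1 hc (hD.sub (.const 1))
    (by rw [integral_sub (hD.integrable π) (integrable_const _), h1]; simp) m
  rw [transOp_iterate_sub_const hD] at h3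
  have hβ : 0 ≤ 1 - c ^ 2 / 2 := by nlinarith
  have h4 : (1 - c ^ 2 / 2) ^ m ≤ Real.exp (-(c ^ 2 / 2)) ^ m :=
    pow_le_pow_left₀ hβ (by linarith [Real.add_one_le_exp (-(c ^ 2 / 2))]) m
  have h5 : ((1 - c ^ 2 / 2) ^ m) ^ 2 ≤ M⁻¹ := by
    refine (pow_le_pow_left₀ (pow_nonneg hβ m) h4 2).trans ?_
    rw [← Real.exp_nat_mul, ← Real.exp_nat_mul, ← Real.exp_log (inv_pos.2 (by linarith : 0 < M)),
      Real.exp_le_exp, Real.log_inv]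
    push_cast
    linarith
  refine h3.trans ((mul_le_mul h5 h2 (integral_nonneg fun x => sq_nonneg _)
    (inv_nonneg.2 (by linarith))).trans (le_of_eq ?_))
  exact inv_mul_cancel₀ (by linarith)

/-- The mean square error after burn-in: geometric decay of correlations bounds the second moment
of the centred sum by `12 n F²/c²`. -/
lemma mcmcError_le_of_log_le (hlazy : IsLazy K) (hrev : K.IsReversible π)
    (hX : IsMarkovChain X K ν P)
    {c : ℝ} (hc0 : 0 < c) (hc1 : c ≤ 1) (hc : ENNReal.ofReal c ≤ conductance K π)
    (hD : BddMeasurable D) (hD0 : ∀ x, 0 ≤ D x) {M : ℝ} (hDM : ∀ x, D x ≤ M)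
    (hνD : ∀ h : Ω → ℝ, ∫ x, h x ∂ν = ∫ x, D x * h x ∂π)
    (hk : BddMeasurable k) {F : ℝ} (hF : 0 ≤ F) (hkF : ∀ x, |k x| ≤ F) (hfk : f =ᵐ[π] k)
    {n n₀ : ℕ} (hn : 1 ≤ n) (hn₀ : Real.log M ≤ n₀ * c ^ 2) :
    mcmcError X P π n n₀ f ≤ ENNReal.ofReal (10 / (c * Real.sqrt n) * F) := by
  have hac := hX.map_absolutelyContinuous hrev hD hνD
  have hn0 : (0 : ℝ) < n := by exact_mod_cast hn
  refine mcmcError_le hX hac hk hfk hn (by positivity) ?_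
  set S := ∫ x, k x ∂π with hS
  have hg : BddMeasurable fun x => k x - S := hk.sub (.const S)
  have hSF : |S| ≤ F := by
    have := norm_integral_le_of_norm_le_const (μ := π) (f := k) (Filter.Eventually.of_forall hkF)
    simpa using this
  have hgF : ∀ x, |k x - S| ≤ 2 * F := fun x => by
    refine (abs_sub _ _).trans ?_
    linarith [hkF x]
  have hmean : ∫ x, (k x - S) ∂π = 0 := by
    rw [integral_sub (hk.integrable π) (integrable_const _)]
    simp [hS]
  -- The variance is at most the second moment.
  have hg2 : ∫ x, (k x - S) ^ 2 ∂π ≤ F ^ 2 := by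
    have e1 : ∫ x, (k x - S) ^ 2 ∂π = ∫ x, k x ^ 2 ∂π - S ^ 2 := by
      have : ∀ x, (k x - S) ^ 2 = k x ^ 2 - (2 * S * k x - S ^ 2) := fun x => by ring
      simp only [this]
      rw [integral_sub (hk.sq.integrable π)
        ((((BddMeasurable.const (2 * S)).mul hk).sub (.const _)).integrable π),
        integral_sub (((BddMeasurable.const (2 * S)).mul hk).integrable π) (integrable_const _),
        integral_const_mul, ← hS]
      simp
      ring
    have e2 : ∫ x, k x ^ 2 ∂π ≤ F ^ 2 := by
      have := integral_mono (hk.sq.integrable π) (integrable_const (F ^ 2)) fun x =>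
        sq_le_sq.2 ((hkF x).trans (le_abs_self F))
      simpa using this
    linarith [sq_nonneg S]
  have hβ0 : 0 ≤ 1 - c ^ 2 / 2 := by nlinarith
  have hcor : ∀ j l, ∫ ω, (k (X (j + n₀) ω) - S) * (k (X (j + l + n₀) ω) - S) ∂P
      ≤ 3 * F ^ 2 * (1 - c ^ 2 / 2) ^ l := by
    intro j l
    have hm : Real.log M ≤ ((j + n₀ : ℕ) : ℝ) * c ^ 2 := by
      push_cast
      nlinarith [mul_nonneg (Nat.cast_nonneg (α := ℝ) j) (sq_nonneg c)]
    have := hX.integral_mul_le hrev hD hνD hg (pow_nonneg hβ0 l) hgF hg2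
      (integral_transOp_iterate_density_sub_one_sq_le hlazy hrev hc0.le hc1 hc hD hD0 hDM hνD hm)
      (integral_transOp_iterate_sq_le hlazy hrev hc0.le hc1 hc hg hmean l)
    rwa [Nat.add_right_comm] at this
  have hsum := integral_sum_sq_le (P := P) (Y := fun j ω => k (X (j + n₀) ω) - S)
    (fun i j => ((hg.comp measurable_fst).mul (hg.comp measurable_snd)).integrable_comp
      ((hX.aemeasurable (i + n₀)).prodMk (hX.aemeasurable (j + n₀))))
    (by positivity) hβ0 (by nlinarith) hcor n
  refine hsum.trans ?_
  have e : (n * (10 / (c * Real.sqrt n) * F)) ^ 2 = n * (100 * F ^ 2 / c ^ 2) := by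
    have hs : Real.sqrt n ^ 2 = n := Real.sq_sqrt hn0.le
    have hs0 : 0 < Real.sqrt n := Real.sqrt_pos.2 hn0
    field_simp
    rw [hs]
    ring
  rw [e]
  refine mul_le_mul_of_nonneg_left ?_ hn0.le
  rw [div_le_div_iff₀ (by nlinarith) (by positivity)]
  nlinarith [mul_nonneg (sq_nonneg F) (sq_nonneg c)]

/-- The error bound in the form with values in `[0,∞]`. -/
lemma mcmcError_le_div (hlazy : IsLazy K) (hrev : K.IsReversible π)
    (hνπ : ν ≪ π) (hbdd : densityNorm ν π < ∞) (hX : IsMarkovChain X K ν P)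
    (hf : MemLp f ∞ π) {n n₀ : ℕ} (hn : 1 ≤ n) (hn₀ : burnIn K ν π ≤ (n₀ : ℝ≥0∞)) :
    mcmcError X P π n n₀ f
      ≤ 10 / (conductance K π * ENNReal.ofReal (Real.sqrt n)) * eLpNorm f ∞ π := by
  obtain ⟨D, hD, hD0, hDM, hνD⟩ := exists_bddMeasurable_density hνπ hbdd
  obtain ⟨k, hk, hkF, hfk⟩ := hf.exists_bddMeasurable
  have hac := hX.map_absolutelyContinuous hrev hD hνD
  have hn0 : (0 : ℝ) < n := by exact_mod_cast hn
  have hs0 : 0 < Real.sqrt n := Real.sqrt_pos.2 hn0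
  rcases eq_or_ne (eLpNorm f ∞ π) 0 with hF0 | hF0
  · have hk0 : ∀ x, k x = 0 := fun x => by simpa [hF0] using hkF x
    rw [mcmcError_eq_zero hX hac hk hfk hn (by simp [hk0])]
    exact zero_le
  rcases eq_or_ne (conductance K π) ∞ with htop | htop
  · have hmean : ∫ x, (k x - ∫ y, k y ∂π) ∂π = 0 := by
      rw [integral_sub (hk.integrable π) (integrable_const _)]
      simp
    rw [mcmcError_eq_zero hX hac hk hfk hn (integral_sq_eq_zero_of_two_le_conductance hlazy hrev
      (by simp [htop]) (hk.sub (.const _)) hmean)]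
    exact zero_le
  rcases eq_or_ne (conductance K π) 0 with h0 | h0
  · rw [h0, zero_mul, ENNReal.div_zero (by norm_num), ENNReal.top_mul hF0]
    exact le_top
  have hc1 : (conductance K π).toReal ≤ 1 :=
    ENNReal.toReal_le_of_le_ofReal zero_le_one (by simpa using conductance_le_one htop)
  have hc0 : 0 < (conductance K π).toReal := ENNReal.toReal_pos h0 htop
  have hlog : Real.log (densityNorm ν π).toReal ≤ n₀ * (conductance K π).toReal ^ 2 := by
    rw [burnIn, ENNReal.div_le_iff (pow_ne_zero _ h0) (ENNReal.pow_ne_top htop)] at hn₀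
    rw [← ENNReal.ofReal_le_ofReal_iff (by positivity), ENNReal.ofReal_mul (by positivity),
      ENNReal.ofReal_pow hc0.le, ENNReal.ofReal_toReal htop, ENNReal.ofReal_natCast]
    exact hn₀
  refine (mcmcError_le_of_log_le hlazy hrev hX hc0 hc1 ENNReal.ofReal_toReal_le hD hD0 hDM hνD hk
    ENNReal.toReal_nonneg hkF hfk hn hlog).trans (le_of_eq ?_)
  rw [ENNReal.ofReal_mul (by positivity), ENNReal.ofReal_div_of_pos (by positivity),
    ENNReal.ofReal_mul hc0.le, ENNReal.ofReal_toReal htop, ENNReal.ofReal_toReal hf.2.ne,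
    ENNReal.ofReal_ofNat]

end Error

lemma ten_div_mul_le_of_hundred_mul_div_le {φ F : ℝ≥0∞} (hφ0 : φ ≠ 0) (hφ : φ ≠ ∞) (hF : F ≠ ∞)
    {ε : ℝ} (hε : 0 < ε) {n : ℕ} (hn : 1 ≤ n)
    (h : 100 * F ^ 2 / (φ ^ 2 * ENNReal.ofReal ε ^ 2) ≤ (n : ℝ≥0∞)) :
    10 / (φ * ENNReal.ofReal (Real.sqrt n)) * F ≤ ENNReal.ofReal ε := by
  have hn0 : (0 : ℝ) < n := by exact_mod_cast hn
  have hs0 : 0 < Real.sqrt n := Real.sqrt_pos.2 hn0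
  have hc0 : 0 < φ.toReal := ENNReal.toReal_pos hφ0 hφ
  lift F to NNReal using hF
  lift φ to NNReal using hφ
  simp only [ENNReal.coe_toReal] at hc0
  have hφε : (φ : ℝ≥0∞) ^ 2 * ENNReal.ofReal ε ^ 2 = ENNReal.ofReal ((φ * ε) ^ 2) := by
    rw [ENNReal.ofReal_pow (by positivity), ENNReal.ofReal_mul hc0.le, ENNReal.ofReal_coe_nnreal,
      mul_pow]
  have hF2 : 100 * (F : ℝ≥0∞) ^ 2 = ENNReal.ofReal ((10 * F) ^ 2) := by
    rw [ENNReal.ofReal_pow (by positivity), ENNReal.ofReal_mul (by norm_num),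
      ENNReal.ofReal_coe_nnreal, mul_pow, ENNReal.ofReal_ofNat]
    norm_num
  rw [hφε, hF2, ← ENNReal.ofReal_div_of_pos (by positivity), ← ENNReal.ofReal_natCast,
    ENNReal.ofReal_le_ofReal_iff hn0.le, ← div_pow] at h
  have h1 := Real.le_sqrt_of_sq_le h
  rw [div_le_iff₀ (by positivity)] at h1
  have e : 10 / ((φ : ℝ≥0∞) * ENNReal.ofReal (Real.sqrt n)) * F
      = ENNReal.ofReal (10 / (φ * Real.sqrt n) * F) := by
    rw [ENNReal.ofReal_mul (by positivity), ENNReal.ofReal_div_of_pos (by positivity),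
      ENNReal.ofReal_mul hc0.le, ENNReal.ofReal_coe_nnreal, ENNReal.ofReal_coe_nnreal,
      ENNReal.ofReal_ofNat]
  rw [e]
  refine ENNReal.ofReal_le_ofReal ?_
  rw [div_mul_eq_mul_div, div_le_iff₀ (by positivity)]
  linarith

theorem mainTheorem2 {Ω Ω' : Type*} [MeasurableSpace Ω] [MeasurableSpace.CountablyGenerated Ω]
    [MeasurableSpace Ω']
    (K : Kernel Ω Ω) [IsMarkovKernel K]
    (π ν : Measure Ω) [IsProbabilityMeasure π] [IsProbabilityMeasure ν]
    (hlazy : IsLazy K) (hrev : K.IsReversible π)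
    (hνπ : ν ≪ π) (hbdd : densityNorm ν π < ∞)
    (P : Measure Ω') [IsProbabilityMeasure P]
    (X : ℕ → Ω' → Ω) (hX : IsMarkovChain X K ν P)
    (f : Ω → ℝ) (hf : MemLp f ∞ π) :
    (∀ n n₀ : ℕ, 1 ≤ n → burnIn K ν π ≤ (n₀ : ℝ≥0∞) →
      mcmcError X P π n n₀ f
        ≤ 10 / (conductance K π * ENNReal.ofReal (Real.sqrt n)) * eLpNorm f ∞ π) ∧
    (eLpNorm f ∞ π ≠ 0 → conductance K π ≠ ∞ → ∀ ε : ℝ, 0 < ε →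
      mcmcCost X P π f ε
        ≤ ENat.ceil (burnIn K ν π)
          + ENat.ceil (100 * eLpNorm f ∞ π ^ 2
              / (conductance K π ^ 2 * ENNReal.ofReal ε ^ 2))) := by
  refine ⟨fun n n₀ hn hn₀ => mcmcError_le_div hlazy hrev hνπ hbdd hX hf hn hn₀, ?_⟩
  intro hF0 hφ ε hε
  have hε0 : ENNReal.ofReal ε ≠ 0 := (ENNReal.ofReal_pos.2 hε).ne'
  have hnum : 100 * eLpNorm f ∞ π ^ 2 ≠ 0 := mul_ne_zero (by norm_num) (pow_ne_zero _ hF0)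
  -- The bound is infinite if the conductance vanishes.
  rcases eq_or_ne (conductance K π) 0 with h0 | h0
  · rw [h0, zero_pow two_ne_zero, zero_mul, ENNReal.div_zero hnum, ENat.ceil_top, add_top]
    exact le_top
  have hb : burnIn K ν π ≠ ∞ := ENNReal.div_ne_top ENNReal.ofReal_ne_top (pow_ne_zero _ h0)
  have hden0 : conductance K π ^ 2 * ENNReal.ofReal ε ^ 2 ≠ 0 :=
    mul_ne_zero (pow_ne_zero _ h0) (pow_ne_zero _ hε0)
  have hden : conductance K π ^ 2 * ENNReal.ofReal ε ^ 2 ≠ ∞ :=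
    ENNReal.mul_ne_top (ENNReal.pow_ne_top hφ) (ENNReal.pow_ne_top ENNReal.ofReal_ne_top)
  have hq : 100 * eLpNorm f ∞ π ^ 2 / (conductance K π ^ 2 * ENNReal.ofReal ε ^ 2) ≠ ∞ :=
    ENNReal.div_ne_top (ENNReal.mul_ne_top (by norm_num) (ENNReal.pow_ne_top hf.2.ne)) hden0
  have hq0 := ENNReal.div_pos hnum hden
  obtain ⟨n₀, hn₀⟩ := ENat.ne_top_iff_exists.1 (ENat.ceil_eq_top.not.2 hb)
  obtain ⟨n, hn⟩ := ENat.ne_top_iff_exists.1 (ENat.ceil_eq_top.not.2 hq)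
  have hbn : burnIn K ν π ≤ (n₀ : ℝ≥0∞) := by
    simpa using ENat.ceil_le.1 hn₀.ge
  have hqn : 100 * eLpNorm f ∞ π ^ 2 / (conductance K π ^ 2 * ENNReal.ofReal ε ^ 2)
      ≤ (n : ℝ≥0∞) := by
    simpa using ENat.ceil_le.1 hn.ge
  have hn1 : 1 ≤ n := by
    have := hq0.trans_le hqn
    exact_mod_cast this
  rw [← hn₀, ← hn, add_comm]
  refine iInf_le_of_le n <| iInf_le_of_le n₀ <| iInf_le_of_le hn1 <| iInf_le_of_le ?_ (by simp)
  exact (mcmcError_le_div hlazy hrev hνπ hbdd hX hf hn1 hbn).trans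
    (ten_div_mul_le_of_hundred_mul_div_le h0 hφ hf.2.ne hε hn1 hqn)
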